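/- **Setting.** Let $f:\mathbb R\times\mathbb R^m\to\mathbb R^m$ be of class $C^r$ and consider $\dot u=f(t,u)$. Let $\ell\ge1$ and let $G_1,\dots,G_\ell:\mathbb R^m\to\mathbb R$ be $C^1$ conserved quantities, i.e. $\nabla G_i(u)^{T}f(t,u)=0$ for all $t,u$. Let $A=(a_{ij})\in\mathbb R^{s\times s}$, $c=A(1,\dots,1)^T$, and $b^1,\dots,b^\ell\in\mathbb R^s$ be the coefficients of $\ell$ embedded Runge–Kutta methods $(A,b^k)$. One step of size $\Delta t>0$ from $(t_n,u^n)$ uses stage values $g_i=u^n+\Delta t\sum_j a_{ij}f(t_n+c_j\Delta t,g_j)$ (for implicit methods, a branch of solutions with $g_i\to u^n$ as $\Delta t\to0$, uniformly on the set $K$ below) and the increments $d_k^n=\sum_j b^k_jf(t_n+c_j\Delta t,g_j)$. The Runge–Kutta method $(A,b^k)$ gives $u^n+\Delta t\,d_k^n$. The generalized relaxation method gives $$u^{n+1}_{\gamma}=u^n+\Delta t\,d_1^n+\Delta t\sum_{i=1}^{\ell}\gamma_i d_i^n,\qquad G_i(u^{n+1}_\gamma)=G_i(u^n)\quad(1\le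 i\le\ell),$$ where $\gamma=\gamma(t_n,u^n,\Delta t)\in\mathbb R^\ell$ solves the $\ell$ conservation equations for all sufficiently small $\Delta t$. **Order.** Let $K\subset\mathbb R\times\mathbb R^m$ be a compact set of starting points $(t_n,u^n)$ (for instance a single point), and let $u$ denote the exact solution with $u(t_n)=u^n$. A step $v=v(t_n,u^n,\Delta t)$, interpreted as an approximation of $u(\tau)$ with $\tau=\tau(t_n,u^n,\Delta t)$, has order (at least) $q$ on $K$ if $v-u(\tau)=O(\Delta t^{q+1})$ as $\Delta t\to0^+$, uniformly for $(t_n,u^n)\in K$. A Runge–Kutta method has order (at least) $p$ if its step, interpreted as an approximation of $u(t_n+\Delta t)$, has order $p$ on every compact set, for every initial value problem in every dimension with right-hand side of class $C^r$. **Theorem.** Let $p\ge2$ and $p\le r\le\infty$, and suppose that each of the $\ell$ embedded Runge–Kutta methods $(A,b^k)$ has order $p$. Let $K$ be compact, let the relaxation parameters be as above for starting points in $K$, and assume $\gamma_i=O(\Delta t^{p-1})$ for all $i$, uniformly on $K$. Then: 1. if $u^{n+1}_\gamma$ is interpreted as an approximation of $u(t_n+\Delta t)$, the generalized relaxation method has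 order $p-1$ on $K$; 2. if $u^{n+1}_\gamma$ is interpreted as an approximation of $u\bigl(t_n+(1+\sum_{i=1}^\ell\gamma_i)\Delta t\bigr)$, it has order $p$ on $K$. -/

import Mathlib

open Filter Topology Asymptotics Set

namespace RelaxRK

/-- The state space `ℝᵐ` with its Euclidean norm. -/
abbrev State (m : ℕ) : Type := EuclideanSpace ℝ (Fin m)

/-- The data of one step: `q.t` is the current time, `q.u` the current value, and
`q.h` the step size. -/
structure StepData (m : ℕ) where
  t : ℝ
  u : State m
  h : ℝ

/-- Step sizes `h → 0⁺`, uniformly with respect to the starting point `(t, u) ∈ K`: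
a property holds eventually along this filter iff there is `h₀ > 0` such that it holds for
all `(t, u) ∈ K` and all `0 < h < h₀` (see `eventually_smallStep`). -/
def smallStep {m : ℕ} (K : Set (ℝ × State m)) : Filter (StepData m) :=
  Filter.comap (fun q : StepData m => ((q.t, q.u), q.h)) (𝓟 K ×ˢ 𝓝[>] (0 : ℝ))

theorem eventually_smallStep {m : ℕ} (K : Set (ℝ × State m)) (P : StepData m → Prop) :
    (∀ᶠ q in smallStep K, P q) ↔
      ∃ h₀ > 0, ∀ t u h, (t, u) ∈ K → 0 < h → h < h₀ → P ⟨t, u, h⟩ := by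
  have hb := ((hasBasis_principal K).prod (nhdsGT_basis (0 : ℝ))).comap
    (fun q : StepData m => ((q.t, q.u), q.h))
  rw [smallStep, hb.eventually_iff]
  constructor
  · rintro ⟨⟨_, h₀⟩, ⟨_, hpos⟩, H⟩
    exact ⟨h₀, hpos, fun t u h hK h1 h2 => H (x := ⟨t, u, h⟩) ⟨hK, h1, h2⟩⟩
  · rintro ⟨h₀, hpos, H⟩
    exact ⟨((), h₀), ⟨trivial, hpos⟩, fun q hq => H q.t q.u q.h hq.1 hq.2.1 hq.2.2⟩

/-- The abscissae `c = A e`. -/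
def abscissa {s : ℕ} (A : Matrix (Fin s) (Fin s) ℝ) (j : Fin s) : ℝ := ∑ k, A j k

/-- The increment `d = ∑ⱼ bⱼ f(t + cⱼ h, gⱼ)` belonging to the weights `b` and the stage
values `g`. -/
noncomputable def increment {s m : ℕ} (A : Matrix (Fin s) (Fin s) ℝ) (b : Fin s → ℝ)
    (f : ℝ → State m → State m) (g : Fin s → State m) (q : StepData m) : State m :=
  ∑ j, b j • f (q.t + abscissa A j * q.h) (g j)

/-- `g` is a solution branch of the stage equations
`gᵢ = u + h ∑ⱼ aᵢⱼ f(t + cⱼ h, gⱼ)` for small `h > 0`, uniformly in `(t, u) ∈ K`.  For implicit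
methods the (possibly non-unique) stage values are those that converge to `u` as `h → 0`. -/
def IsStageBranch {s m : ℕ} (A : Matrix (Fin s) (Fin s) ℝ) (f : ℝ → State m → State m)
    (K : Set (ℝ × State m)) (g : StepData m → Fin s → State m) : Prop :=
  (∀ᶠ q in smallStep K, ∀ i, g q i = q.u + q.h • increment A (A i) f (g q) q) ∧
  ∀ i, Tendsto (fun q => g q i - q.u) (smallStep K) (𝓝 0)

/-- For every `(t, u) ∈ K`, `Y t u` solves `y' = f(s, y)`, `y(t) = u` on `[t, t + T]`, where
the length `T > 0` does not depend on `(t, u) ∈ K`. -/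
def IsExactSolution {m : ℕ} (f : ℝ → State m → State m) (K : Set (ℝ × State m))
    (Y : ℝ → State m → ℝ → State m) : Prop :=
  ∃ T > 0, ∀ t u, (t, u) ∈ K → Y t u t = u ∧
    ∀ x ∈ Icc t (t + T), HasDerivWithinAt (Y t u) (f x (Y t u x)) (Icc t (t + T)) x

/-- One step `v` of a one-step method, started on an exact solution, read as an approximation
of the exact solution at the time `τ`, has order `r`: the local error is `O(h^(r+1))`,
uniformly for `(t, u) ∈ K`. -/
def HasLocalOrder {m : ℕ} (K : Set (ℝ × State m)) (Y : ℝ → State m → ℝ → State m)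
    (v : StepData m → State m) (τ : StepData m → ℝ) (r : ℕ) : Prop :=
  (fun q => v q - Y q.t q.u (τ q)) =O[smallStep K] fun q => q.h ^ (r + 1)

/-- The Runge-Kutta method `(A, b)` has order (at least) `p`: for all initial value problems,
in all dimensions, with right-hand side of class `C^r`, one step of size `h` has local error
`O(h^(p+1))`, uniformly for initial data in a compact set. -/
def RKHasOrder {s : ℕ} (r : ℕ∞) (A : Matrix (Fin s) (Fin s) ℝ) (b : Fin s → ℝ)
    (p : ℕ) : Prop :=
  ∀ (m : ℕ) (f : ℝ → State m → State m), ContDiff ℝ r (fun x : ℝ × State m => f x.1 x.2) →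
  ∀ (K : Set (ℝ × State m)), IsCompact K →
  ∀ g : StepData m → Fin s → State m, IsStageBranch A f K g →
  ∀ Y : ℝ → State m → ℝ → State m, IsExactSolution f K Y →
    HasLocalOrder K Y (fun q => q.u + q.h • increment A b f (g q) q) (fun q => q.t + q.h) p

/-- `G` is a (continuously differentiable) conserved quantity of `u' = f(t, u)`. -/
def IsConserved {m : ℕ} (f : ℝ → State m → State m) (G : State m → ℝ) : Prop :=
  ContDiff ℝ 1 G ∧ ∀ t u, fderiv ℝ G u (f t u) = 0

/-- The relaxed update `u_γ = (u + h d₁) + h ∑ᵢ γᵢ dᵢ`; the index `0` of `b` is the first of the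
`ℓ` embedded methods `(A, b i)`, which share the stage values `g`. -/
noncomputable def relaxedUpdate {s ℓ m : ℕ} [NeZero ℓ] (A : Matrix (Fin s) (Fin s) ℝ)
    (b : Fin ℓ → Fin s → ℝ) (f : ℝ → State m → State m) (g : Fin s → State m)
    (γ : Fin ℓ → ℝ) (q : StepData m) : State m :=
  (q.u + q.h • increment A (b 0) f g q) + q.h • ∑ i, γ i • increment A (b i) f g q

end RelaxRK

namespace RelaxRK

/-! Write ε = ∑ γᵢ and f = f(t, u). The error at the shifted time splits into three pieces: the
error of the first embedded method at t + h, the term h ∑ γᵢ (dᵢ - f), and minus the defect Y(t + (1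
+ ε)h) - Y(t + h) - εh f. The two terms εh f cancel because every embedded method has weights
summing to one (`RKHasOrder.sum_weights_eq_one`). The first piece is O(h^(p+1)) by assumption. In
the second, dᵢ - f = O(h) (`increment_sub_isBigO`); the third is O(h · εh)
(`IsExactSolution.sub_sub_isBigO`). With γᵢ = O(h^(p-1)) both are O(h^(p+1)). At the unshifted time,
bounded dᵢ only give h ∑ γᵢ dᵢ = O(h^p), hence the loss of one order. -/

/-- A `C¹` map is bounded on a compact set, and Lipschitz there against all points at distance
at most one, with uniform constants. -/
theorem exists_lipschitz_near_compact {E F : Type*} [NormedAddCommGroup E] [NormedSpace ℝ E]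
    [ProperSpace E] [NormedAddCommGroup F] [NormedSpace ℝ F] {φ : E → F} (hφ : ContDiff ℝ 1 φ)
    {K : Set E} (hK : IsCompact K) :
    ∃ L M : ℝ, 0 ≤ L ∧ 0 ≤ M ∧
      ∀ z ∈ K, ‖φ z‖ ≤ M ∧ ∀ w, ‖w - z‖ ≤ 1 → ‖φ w - φ z‖ ≤ L * ‖w - z‖ := by
  obtain ⟨R, hR⟩ := hK.isBounded.subset_closedBall (0 : E)
  -- Enlarging the radius by one captures every w within distance one of K in a convex set, so the
  -- mean value inequality applies.
  have hB : IsCompact (Metric.closedBall (0 : E) (R + 1)) := isCompact_closedBall _ _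
  obtain ⟨L, hL⟩ := hB.exists_bound_of_continuousOn (hφ.continuous_fderiv one_ne_zero).continuousOn
  obtain ⟨M, hM⟩ := hB.exists_bound_of_continuousOn hφ.continuous.continuousOn
  refine ⟨|L|, |M|, abs_nonneg _, abs_nonneg _, fun z hz => ?_⟩
  have hzR : ‖z‖ ≤ R := by simpa using hR hz
  have hz' : z ∈ Metric.closedBall (0 : E) (R + 1) := by simp; linarith
  refine ⟨(hM z hz').trans (le_abs_self _), fun w hw => ?_⟩
  have hw' : w ∈ Metric.closedBall (0 : E) (R + 1) := by
    have := norm_add_le (w - z) z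
    simp at this ⊢; linarith
  exact (convex_closedBall _ _).norm_image_sub_le_of_norm_fderiv_le
    (fun x _ => (hφ.differentiable one_ne_zero) x)
    (fun x hx => (hL x hx).trans (le_abs_self _)) hz' hw'

section Filter

variable {m : ℕ} {K : Set (ℝ × State m)}

theorem eventually_mem_smallStep : ∀ᶠ q in smallStep K, (q.t, q.u) ∈ K ∧ 0 < q.h :=
  (eventually_smallStep K _).2 ⟨1, one_pos, fun _ _ _ hK h0 _ => ⟨hK, h0⟩⟩

theorem tendsto_h_smallStep : Tendsto (fun q : StepData m => q.h) (smallStep K) (𝓝 0) :=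
  (tendsto_snd.mono_right nhdsWithin_le_nhds).comp tendsto_comap

theorem h_isBigO_one : (fun q : StepData m => q.h) =O[smallStep K] fun _ => (1 : ℝ) :=
  tendsto_h_smallStep.isBigO_one ℝ

/-- A `C¹` right-hand side differs along two uniformly close families by a multiple of their
distance. -/
theorem rhs_sub_isBigO {f : ℝ → State m → State m}
    (hf : ContDiff ℝ 1 (fun x : ℝ × State m => f x.1 x.2)) (hK : IsCompact K)
    {x : StepData m → ℝ} {y : StepData m → State m}
    (hx : Tendsto (fun q => x q - q.t) (smallStep K) (𝓝 0))
    (hy : Tendsto (fun q => y q - q.u) (smallStep K) (𝓝 0)) :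
    (fun q => f (x q) (y q) - f q.t q.u) =O[smallStep K]
      fun q => (x q - q.t, y q - q.u) := by
  obtain ⟨L, M, -, -, h⟩ := exists_lipschitz_near_compact hf hK
  have h1 : ∀ᶠ q in smallStep K, ‖(x q - q.t, y q - q.u)‖ ≤ 1 := by
    have := (hx.prodMk_nhds hy).norm
    rw [Prod.mk_zero_zero, norm_zero] at this
    exact this.eventually_le_const one_pos
  refine IsBigO.of_bound L ?_
  filter_upwards [h1, eventually_mem_smallStep] with q hq hqK
  exact (h _ hqK.1).2 (x q, y q) hq

theorem rhs_isBigO_one {f : ℝ → State m → State m}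
    (hf : ContDiff ℝ 1 (fun x : ℝ × State m => f x.1 x.2)) (hK : IsCompact K) :
    (fun q => f q.t q.u) =O[smallStep K] fun _ => (1 : ℝ) := by
  obtain ⟨L, M, -, -, h⟩ := exists_lipschitz_near_compact hf hK
  refine IsBigO.of_bound M ?_
  filter_upwards [eventually_mem_smallStep] with q hqK
  simpa using (h _ hqK.1).1

end Filter

/-! ### Stage values and increments -/

section Stages

variable {s m : ℕ} {K : Set (ℝ × State m)} {A : Matrix (Fin s) (Fin s) ℝ}
  {f : ℝ → State m → State m} {g : StepData m → Fin s → State m}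

theorem abscissa_sub_isBigO (c : ℝ) :
    (fun q : StepData m => q.t + c * q.h - q.t) =O[smallStep K] fun q => q.h := by
  simpa using (isBigO_refl (fun q : StepData m => q.h) (smallStep K)).const_mul_left c

theorem abscissa_sub_tendsto (c : ℝ) :
    Tendsto (fun q : StepData m => q.t + c * q.h - q.t) (smallStep K) (𝓝 0) :=
  (abscissa_sub_isBigO c).trans_tendsto tendsto_h_smallStep

theorem increment_sub_eq (b : Fin s → ℝ) (q : StepData m) (y : Fin s → State m) :
    increment A b f y q - (∑ j, b j) • f q.t q.u =
      ∑ j, b j • (f (q.t + abscissa A j * q.h) (y j) - f q.t q.u) := by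
  simp [increment, smul_sub, Finset.sum_sub_distrib, Finset.sum_smul]

theorem increment_isBigO_one (hf : ContDiff ℝ 1 (fun x : ℝ × State m => f x.1 x.2))
    (hK : IsCompact K) (hg : IsStageBranch A f K g) (b : Fin s → ℝ) :
    (fun q => increment A b f (g q) q) =O[smallStep K] fun _ => (1 : ℝ) := by
  refine IsBigO.fun_sum fun j _ => IsBigO.const_smul_left ?_ (b j)
  have h1 := (rhs_sub_isBigO hf hK (abscissa_sub_tendsto (abscissa A j)) (hg.2 j)).trans
    (((abscissa_sub_tendsto (abscissa A j)).prodMk_nhds (hg.2 j)).isBigO_one ℝ)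
  simpa using h1.add (rhs_isBigO_one hf hK)

/-- Bootstrap: mere convergence of the stages to u already bounds the increments, and the stage
equation then upgrades it to rate h. -/
theorem stage_sub_isBigO (hf : ContDiff ℝ 1 (fun x : ℝ × State m => f x.1 x.2))
    (hK : IsCompact K) (hg : IsStageBranch A f K g) (i : Fin s) :
    (fun q => g q i - q.u) =O[smallStep K] fun q => q.h := by
  have h1 : (fun q : StepData m => q.h • increment A (A i) f (g q) q) =O[smallStep K]
      fun q => q.h • (1 : ℝ) :=
    (isBigO_refl _ _).smul (increment_isBigO_one hf hK hg (A i))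
  refine (h1.congr' ?_ ?_)
  · filter_upwards [hg.1] with q hq
    exact (sub_eq_iff_eq_add'.2 (hq i)).symm
  · exact Eventually.of_forall fun q => by simp

/-- The increments of a Runge-Kutta method are a first-order approximation of the sum of the
weights times the right-hand side. -/
theorem increment_sub_isBigO (hf : ContDiff ℝ 1 (fun x : ℝ × State m => f x.1 x.2))
    (hK : IsCompact K) (hg : IsStageBranch A f K g) (b : Fin s → ℝ) :
    (fun q => increment A b f (g q) q - (∑ j, b j) • f q.t q.u) =O[smallStep K]
      fun q => q.h := by
  simp only [increment_sub_eq]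
  refine IsBigO.fun_sum fun j _ => IsBigO.const_smul_left ?_ (b j)
  exact (rhs_sub_isBigO hf hK (abscissa_sub_tendsto _) (hg.2 j)).trans
    ((abscissa_sub_isBigO _).prod_left (stage_sub_isBigO hf hK hg j))

end Stages

/-- A Runge-Kutta method of order at least one is consistent. -/
theorem RKHasOrder.sum_weights_eq_one {s p : ℕ} (hp : 1 ≤ p) {r : ℕ∞}
    {A : Matrix (Fin s) (Fin s) ℝ} {b : Fin s → ℝ} (h : RKHasOrder r A b p) :
    ∑ j, b j = 1 := by
  -- Test on u' = 1 from 0: the local error is exactly h (∑ bⱼ - 1), so dividing by h and letting h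
  -- → 0 forces the sum to be one.
  set e : State 1 := EuclideanSpace.single 0 1 with he
  set K : Set (ℝ × State 1) := {(0, 0)} with hKdef
  have hinc : ∀ (w : Fin s → ℝ) (y : Fin s → State 1) (q : StepData 1),
      increment A w (fun _ _ => e) y q = (∑ j, w j) • e := by
    intro w y q
    simp [increment, Finset.sum_smul]
  have hord := h 1 (fun _ _ => e) contDiff_const K isCompact_singleton
    (fun q i => q.u + q.h • (∑ j, A i j) • e) ⟨by simp [hinc], fun i => by
      simpa using tendsto_h_smallStep.smul_const ((∑ j, A i j) • e)⟩
    (fun t u x => u + (x - t) • e) ⟨1, one_pos, fun t u _ => ⟨by simp, fun x _ => by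
      simpa using (((hasDerivWithinAt_id x _).sub_const t).smul_const e).const_add u⟩⟩
  simp only [HasLocalOrder, hinc] at hord
  obtain ⟨C, hC⟩ := hord.bound
  obtain ⟨h₀, h₀pos, H⟩ := (eventually_smallStep K _).1 hC
  have hbound : ∀ᶠ x in 𝓝[>] (0 : ℝ), |∑ j, b j - 1| ≤ C * x ^ p := by
    filter_upwards [Ioo_mem_nhdsGT h₀pos] with x hx
    have hx0 : 0 < x := hx.1
    have := H 0 0 x rfl hx.1 hx.2
    rw [show (0 : State 1) + x • (∑ j, b j) • e - (0 + ((0 : ℝ) + x - 0) • e)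
      = (x * (∑ j, b j - 1)) • e by module, norm_smul, norm_mul, norm_pow] at this
    simp only [he, PiLp.norm_single, norm_one, mul_one, Real.norm_eq_abs,
      abs_of_pos hx0] at this
    rw [pow_succ, ← mul_assoc, mul_comm] at this
    exact le_of_mul_le_mul_right this hx0
  have hlim : Tendsto (fun x : ℝ => C * x ^ p) (𝓝[>] 0) (𝓝 0) := by
    have : Continuous fun x : ℝ => C * x ^ p := by fun_prop
    simpa [show p ≠ 0 by omega] using (this.tendsto 0).mono_left nhdsWithin_le_nhds
  have := ge_of_tendsto hlim hbound
  exact sub_eq_zero.1 (abs_nonpos_iff.1 this)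

/-! ### Exact solutions near the initial time -/

/-- Exact solutions leave their initial value at most linearly in time, uniformly for initial
data in a compact set. -/
theorem IsExactSolution.exists_norm_sub_le {m : ℕ} {K : Set (ℝ × State m)}
    {f : ℝ → State m → State m} {Y : ℝ → State m → ℝ → State m}
    (hf : ContDiff ℝ 1 (fun x : ℝ × State m => f x.1 x.2)) (hK : IsCompact K)
    (hY : IsExactSolution f K Y) :
    ∃ δ > 0, ∃ C ≥ 0, ∀ t u, (t, u) ∈ K → ∀ x ∈ Icc t (t + δ),
      HasDerivWithinAt (Y t u) (f x (Y t u x)) (Icc t (t + δ)) x ∧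
      ‖f x (Y t u x) - f t u‖ ≤ C * (x - t) := by
  obtain ⟨T, hT, hY⟩ := hY
  obtain ⟨L, M, hL, hM, hF⟩ := exists_lipschitz_near_compact hf hK
  -- Within unit distance of K the speed is at most M + L, strictly below B as the barrier argument
  -- needs; B ≥ 1 makes B(x - t) dominate the time component too, and δ ≤ 1/B keeps that bound at
  -- most one.
  set B := M + L + 1 with hB
  have hB1 : 1 ≤ B := by linarith
  have hB0 : 0 < B := by linarith
  set δ := min T B⁻¹ with hδ
  have hδ0 : 0 < δ := lt_min hT (inv_pos.2 hB0)
  have hBδ : B * δ ≤ 1 := by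
    calc B * δ ≤ B * B⁻¹ := by gcongr; exact min_le_right _ _
      _ = 1 := mul_inv_cancel₀ hB0.ne'
  refine ⟨δ, hδ0, L * B, by positivity, fun t u htu => ?_⟩
  obtain ⟨h0, hd⟩ := hY t u htu
  have hsub : Icc t (t + δ) ⊆ Icc t (t + T) :=
    Icc_subset_Icc_right (by linarith [min_le_left T B⁻¹])
  have hd' : ∀ x ∈ Icc t (t + δ),
      HasDerivWithinAt (Y t u) (f x (Y t u x)) (Icc t (t + δ)) x :=
    fun x hx => (hd x (hsub hx)).mono hsub
  have hnear : ∀ x ∈ Icc t (t + δ), ‖Y t u x - u‖ ≤ B * (x - t) →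
      ‖(x, Y t u x) - (t, u)‖ ≤ B * (x - t) := by
    intro x hx hn
    rw [Prod.mk_sub_mk, Prod.norm_mk, Real.norm_eq_abs, abs_of_nonneg (by linarith [hx.1])]
    exact max_le (by nlinarith [hx.1]) hn
  have hle1 : ∀ x ∈ Icc t (t + δ), B * (x - t) ≤ 1 := fun x hx =>
    (mul_le_mul_of_nonneg_left (by linarith [hx.2]) hB0.le).trans hBδ
  have hgrow : ∀ x ∈ Icc t (t + δ), ‖Y t u x - u‖ ≤ B * (x - t) := by
    -- The speed bound is needed only where the norm meets the barrier B(x - t); there the point is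
    -- still within unit distance, so nothing is circular.
    refine fun x hx => image_norm_le_of_norm_deriv_right_lt_deriv_boundary'
      (f := fun x => Y t u x - u) (f' := fun x => f x (Y t u x))
      (B := fun x => B * (x - t)) (B' := fun _ => B)
      (fun x hx => ((hd' x hx).continuousWithinAt).sub continuousWithinAt_const)
      (fun x hx => ((hd' x (Ico_subset_Icc_self hx)).mono_of_mem_nhdsWithin
        (Icc_mem_nhdsGE_of_mem hx)).sub_const u)
      (by simp [h0]) (by fun_prop)
      (fun x _ => by simpa using (((hasDerivWithinAt_id x _).sub_const t).const_mul B))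
      (fun x hx heq => ?_) hx
    have hx' := Ico_subset_Icc_self hx
    have h1 := (hnear x hx' heq.le).trans (hle1 x hx')
    have h2 : ‖f x (Y t u x) - f t u‖ ≤ L * ‖(x, Y t u x) - (t, u)‖ :=
      (hF _ htu).2 (x, Y t u x) h1
    have h3 : ‖f t u‖ ≤ M := (hF _ htu).1
    have h4 := norm_add_le (f x (Y t u x) - f t u) (f t u)
    rw [sub_add_cancel] at h4
    nlinarith
  refine fun x hx => ⟨hd' x hx, ?_⟩
  have h1 := hnear x hx (hgrow x hx)
  calc ‖f x (Y t u x) - f t u‖ ≤ L * ‖(x, Y t u x) - (t, u)‖ :=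
        (hF _ htu).2 (x, Y t u x) (h1.trans (hle1 x hx))
    _ ≤ L * (B * (x - t)) := by gcongr
    _ = L * B * (x - t) := by ring

/-- Shifting the evaluation time `t + h` of the exact solution by `ε h` with `ε → 0` changes the
value by `ε h f(t, u)`, up to `O(ε h²)`. -/
theorem IsExactSolution.sub_sub_isBigO {m : ℕ} {K : Set (ℝ × State m)}
    {f : ℝ → State m → State m} {Y : ℝ → State m → ℝ → State m}
    (hf : ContDiff ℝ 1 (fun x : ℝ × State m => f x.1 x.2)) (hK : IsCompact K)
    (hY : IsExactSolution f K Y) {ε : StepData m → ℝ}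
    (hε : Tendsto ε (smallStep K) (𝓝 0)) :
    (fun q => Y q.t q.u (q.t + (1 + ε q) * q.h) - Y q.t q.u (q.t + q.h)
      - (ε q * q.h) • f q.t q.u) =O[smallStep K] fun q => q.h * (ε q * q.h) := by
  obtain ⟨δ, hδ, C, hC, H⟩ := hY.exists_norm_sub_le hf hK
  refine IsBigO.of_bound (2 * C) ?_
  have h1 : ∀ᶠ q in smallStep K, |ε q| ≤ 1 := by
    have := hε.abs
    rw [abs_zero] at this
    exact this.eventually_le_const one_pos
  filter_upwards [h1, eventually_mem_smallStep,
    tendsto_h_smallStep.eventually_le_const (half_pos hδ)] with q hq hqK hqh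
  obtain ⟨hqK, hq0⟩ := hqK
  obtain ⟨hq1, hq2⟩ := abs_le.1 hq
  have hsub : Icc q.t (q.t + 2 * q.h) ⊆ Icc q.t (q.t + δ) :=
    Icc_subset_Icc_right (by linarith)
  -- Mean value inequality for Y(x) - x f(t, u); since |ε| ≤ 1, both times lie in [t, t + 2h]
  -- whatever the sign of ε.
  have key := (convex_Icc q.t (q.t + 2 * q.h)).norm_image_sub_le_of_norm_hasDerivWithin_le
    (f := fun x => Y q.t q.u x - x • f q.t q.u)
    (f' := fun x => f x (Y q.t q.u x) - f q.t q.u) (C := 2 * C * q.h)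
    (x := q.t + q.h) (y := q.t + (1 + ε q) * q.h)
    (fun x hx => by
      simpa using ((H _ _ hqK x (hsub hx)).1.mono hsub).fun_sub
        ((hasDerivWithinAt_id x _).smul_const (f q.t q.u)))
    (fun x hx => ((H _ _ hqK x (hsub hx)).2).trans (by nlinarith [hx.2]))
    ⟨by linarith, by linarith⟩ ⟨by nlinarith, by nlinarith⟩
  rw [show q.t + (1 + ε q) * q.h - (q.t + q.h) = ε q * q.h by ring] at key
  rw [norm_mul q.h, Real.norm_of_nonneg hq0.le, ← mul_assoc]
  refine le_trans (le_of_eq ?_) key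
  congr 1
  module

end RelaxRK

theorem mainTheorem2 {s ℓ m p : ℕ} [NeZero ℓ] (hp : 2 ≤ p) (r : ℕ∞) (hr : (p : ℕ∞) ≤ r)
    -- the embedded methods
    (A : Matrix (Fin s) (Fin s) ℝ) (b : Fin ℓ → Fin s → ℝ)
    (hb : ∀ i, RelaxRK.RKHasOrder r A (b i) p)
    -- the initial value problem and its conserved quantities
    (f : ℝ → RelaxRK.State m → RelaxRK.State m)
    (hf : ContDiff ℝ r (fun x : ℝ × RelaxRK.State m => f x.1 x.2))
    (G : Fin ℓ → RelaxRK.State m → ℝ) (hG : ∀ i, RelaxRK.IsConserved f (G i))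
    -- starting points, exact solutions and stage values
    (K : Set (ℝ × RelaxRK.State m)) (hK : IsCompact K)
    (Y : ℝ → RelaxRK.State m → ℝ → RelaxRK.State m) (hY : RelaxRK.IsExactSolution f K Y)
    (g : RelaxRK.StepData m → Fin s → RelaxRK.State m) (hg : RelaxRK.IsStageBranch A f K g)
    -- the relaxation parameters
    (γ : RelaxRK.StepData m → Fin ℓ → ℝ)
    (hγG : ∀ᶠ q in RelaxRK.smallStep K, ∀ i,
      G i (RelaxRK.relaxedUpdate A b f (g q) (γ q) q) = G i q.u)
    (hγ : ∀ i, (fun q => γ q i) =O[RelaxRK.smallStep K] fun q => q.h ^ (p - 1)) :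
    RelaxRK.HasLocalOrder K Y (fun q => RelaxRK.relaxedUpdate A b f (g q) (γ q) q)
      (fun q => q.t + q.h) (p - 1) ∧
    RelaxRK.HasLocalOrder K Y (fun q => RelaxRK.relaxedUpdate A b f (g q) (γ q) q)
      (fun q => q.t + (1 + ∑ i, γ q i) * q.h) p := by
  obtain ⟨n, rfl⟩ : ∃ n, p = n + 2 := ⟨p - 2, by omega⟩
  have hf1 : ContDiff ℝ 1 (fun x : ℝ × RelaxRK.State m => f x.1 x.2) :=
    hf.of_le (by
      have : (1 : ℕ∞) ≤ r := le_trans (by exact_mod_cast (by omega : 1 ≤ n + 2)) hr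
      exact_mod_cast this)
  have hstep : (fun q => q.u + q.h • RelaxRK.increment A (b 0) f (g q) q
      - Y q.t q.u (q.t + q.h)) =O[RelaxRK.smallStep K] fun q => q.h ^ (n + 2 + 1) :=
    hb 0 m f hf K hK g hg Y hY
  have hsum : (fun q => ∑ i, γ q i) =O[RelaxRK.smallStep K] fun q => q.h ^ (n + 1) :=
    IsBigO.fun_sum fun i _ => hγ i
  have hpow : ∀ k, (fun q : RelaxRK.StepData m => q.h ^ (k + 1)) =O[RelaxRK.smallStep K]
      fun q => q.h ^ k := fun k => by
    simpa [pow_succ] using (isBigO_refl (fun q : RelaxRK.StepData m => q.h ^ k) _).mul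
      RelaxRK.h_isBigO_one
  have hsum0 : Tendsto (fun q => ∑ i, γ q i) (RelaxRK.smallStep K) (𝓝 0) := by
    refine hsum.trans_tendsto ?_
    simpa using RelaxRK.tendsto_h_smallStep.pow (n + 1)
  constructor
  · have hcorr : (fun q => q.h • ∑ i, γ q i • RelaxRK.increment A (b i) f (g q) q)
        =O[RelaxRK.smallStep K] fun q => q.h • (q.h ^ (n + 1) • (1 : ℝ)) :=
      (isBigO_refl _ _).smul <| IsBigO.fun_sum fun i _ =>
        (hγ i).smul (RelaxRK.increment_isBigO_one hf1 hK hg (b i))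
    refine ((hstep.trans (hpow _)).add (hcorr.congr_right fun q => ?_)).congr_left fun q => ?_
    · simp only [smul_eq_mul, mul_one]; ring
    · simp only [RelaxRK.relaxedUpdate]; abel
  · have hcorr : (fun q => q.h • ∑ i, γ q i • (RelaxRK.increment A (b i) f (g q) q
        - (∑ j, b i j) • f q.t q.u))
        =O[RelaxRK.smallStep K] fun q => q.h • (q.h ^ (n + 1) • q.h) :=
      (isBigO_refl _ _).smul <| IsBigO.fun_sum fun i _ =>
        (hγ i).smul (RelaxRK.increment_sub_isBigO hf1 hK hg (b i))
    have hshift := (hY.sub_sub_isBigO hf1 hK hsum0).trans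
      ((isBigO_refl (fun q : RelaxRK.StepData m => q.h) _).mul
        (hsum.mul (isBigO_refl (fun q : RelaxRK.StepData m => q.h) _)))
    refine ((hstep.add (hcorr.congr_right fun q => ?_)).sub
      (hshift.congr_right fun q => ?_)).congr_left fun q => ?_
    · simp only [smul_eq_mul]; ring
    · ring
    -- Unit weight sums turn the subtracted terms into h (∑ γᵢ) f(t, u), which cancels the linear
    -- part of the time shift.
    · simp only [(hb _).sum_weights_eq_one (by omega), one_smul, smul_sub,
        Finset.sum_sub_distrib, ← Finset.sum_smul, RelaxRK.relaxedUpdate, smul_smul,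
        mul_comm q.h]
      abel
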